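/- Let $G=(V,E)$ be a finite simple $3$-edge-connected graph with $n=|V|\ge 1$ nodes, and let every node $v$ have a weight $f_v\ge 0$. Let $K_n=(V,E_n)$ be the complete graph on $V$, and let $c\in\mathbb{R}^{E_n}$ be given by $c_{uv}=f_u+f_v$ if $uv\in E$, and otherwise by $c_{uv}=$ the cost of a shortest $u$–$v$ path in $G$, where each edge $ab\in E$ costs $f_a+f_b$. Let $OPT(c)$ be the minimum cost of a Hamiltonian cycle of $K_n$, and let $LP(c)=\min\{cx : x\in S^n\}$, where $S^n$ is the subtour elimination polytope, i.e. the set of $x\in\mathbb{R}^{E_n}$ with $x(\delta(v))=2$ for all $v\in V$, $x(\delta(S))\ge 2$ for all $\emptyset\ne S\subsetneq V$, and $0\le x_e\le 1$ for all $e\in E_n$. Let $T^n$ be the convex hull of the incidence vectors of tours, where a tour is the edge multiset of a spanning, connected multisubgraph of $K_n$ with all degrees even (arbitrary multiplicities allowed). For $\lambda\in\mathbb{R}$, the everywhere $\lambda$ vector for $G$ is the $y\in\mathbb{R}^{E_n}$ with $y_e=\lambda$ for $e\in E$ and $y_e=0$ for $e\in E_n\setminus E$. (a) If $G$ is cubic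 and the everywhere $\lambda$ vector for $G$ is in $T^n$, then $OPT(c)\le\frac32\lambda\,LP(c)$. (b) If $G$ is cubic and Hamiltonian, then $OPT(c)\le\frac97\,LP(c)$. (c) In particular, if $G$ is a fundamental graph, then $G$ is Hamiltonian and $OPT(c)\le\frac97\,LP(c)$. Here a fundamental graph is the support graph (the graph of the edges $e$ with $x_e>0$) of a point $x\in S^n$ whose support graph is cubic, for which exactly one edge with $x_e=1$ is incident to each node, and for which the fractional edges ($0<x_e<1$) either form disjoint $4$-cycles (a Boyd-Carr point) or form a Hamiltonian cycle (a Carr-Vempala point). -/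

import Mathlib

noncomputable section

namespace TSP

/-- The edge set `E_n` of the complete graph on the node set `V`, where `n = |V|`. -/
abbrev Edge (V : Type*) : Type _ := (⊤ : SimpleGraph V).edgeSet

variable {V : Type*} [Fintype V] [DecidableEq V]

/-- The cut `δ(S)`: the edges of the complete graph with one end in `S` and the other outside. -/
def cut (S : Finset V) : Finset (Edge V) :=
  Finset.univ.filter fun e => ∃ u ∈ S, ∃ v ∉ S, (e : Sym2 V) = s(u, v)

/-- The scalar product `c x` of two vectors indexed by the edges of the complete graph. -/
def value (c x : Edge V → ℝ) : ℝ := ∑ e, c e * x e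

variable (V) in
/-- The subtour elimination polytope `S^n`. -/
def subtourPolytope : Set (Edge V → ℝ) :=
  {x | (∀ v : V, ∑ e ∈ cut {v}, x e = 2) ∧
    (∀ S : Finset V, S.Nonempty → S ≠ Finset.univ → 2 ≤ ∑ e ∈ cut S, x e) ∧
    (∀ e, 0 ≤ x e ∧ x e ≤ 1)}

/-- `LP(c)`: the optimal value of the subtour LP, that is, of minimizing `c x` over `S^n`. -/
def LP (c : Edge V → ℝ) : ℝ := sInf (value c '' subtourPolytope V)

/-- `OPT(c)`: the minimum cost of a Hamiltonian cycle of the complete graph. A Hamiltonian cycle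
contributes its incidence vector, the number of its occurrences at every edge. -/
def OPT (c : Edge V → ℝ) : ℝ :=
  sInf {r | ∃ (v : V) (p : (⊤ : SimpleGraph V).Walk v v), p.IsHamiltonianCycle ∧
    r = value c fun e => (p.edges.count (e : Sym2 V) : ℝ)}

/-- A tour: the edge multiset (given by its multiplicities `m`) of a spanning connected
multisubgraph of the complete graph in which all degrees are even. -/
structure IsTour (m : Edge V → ℕ) : Prop where
  connected : (SimpleGraph.fromEdgeSet {e : Sym2 V | ∃ a : Edge V, (a : Sym2 V) = e ∧ 0 < m a}).Connected
  even_degree : ∀ v : V, Even (∑ e ∈ cut {v}, m e)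

variable (V) in
/-- The polyhedron `T^n`: the convex hull of the incidence vectors of tours. -/
def tourPolyhedron : Set (Edge V → ℝ) :=
  convexHull ℝ {x | ∃ m : Edge V → ℕ, IsTour m ∧ x = fun e => (m e : ℝ)}

open Classical in
/-- The everywhere `lam` vector for `G`: it is `lam` on the edges of `G` and `0` elsewhere. -/
def everywhereVector (G : SimpleGraph V) (lam : ℝ) : Edge V → ℝ :=
  fun e => if (e : Sym2 V) ∈ G.edgeSet then lam else 0

/-- The sum `f u + f v` of the node weights of the two ends of the pair `s(u, v)`. -/
def endSum (f : V → ℝ) : Sym2 V → ℝ :=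
  Sym2.lift ⟨fun u v => f u + f v, fun u v => add_comm (f u) (f v)⟩

/-- The cost of a shortest path of `G` between the two ends of `e`, where every edge `ab` of `G`
has length `f a + f b`. -/
def shortestPathCost (G : SimpleGraph V) (f : V → ℝ) (e : Sym2 V) : ℝ :=
  sInf {r | ∃ (u v : V) (p : G.Walk u v), e = s(u, v) ∧ p.IsPath ∧
    r = (p.edges.map (endSum f)).sum}

open Classical in
/-- The cost function of the node-weighted TSP on `G` with node weights `f`. -/
def nodeWeightedCost (G : SimpleGraph V) (f : V → ℝ) : Edge V → ℝ :=
  fun e => if (e : Sym2 V) ∈ G.edgeSet then endSum f e else shortestPathCost G f e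

/-- The support graph of `x`: its edges are the `e` with `x e > 0`. -/
def supportGraph (x : Edge V → ℝ) : SimpleGraph V :=
  SimpleGraph.fromEdgeSet {e : Sym2 V | ∃ a : Edge V, (a : Sym2 V) = e ∧ 0 < x a}

/-- The graph formed by the fractional edges of `x`, those with `0 < x e < 1`. -/
def fractionalGraph (x : Edge V → ℝ) : SimpleGraph V :=
  SimpleGraph.fromEdgeSet {e : Sym2 V | ∃ a : Edge V, (a : Sym2 V) = e ∧ 0 < x a ∧ x a < 1}

open Classical in
/-- The conditions shared by Boyd-Carr and Carr-Vempala points: `x` lies in `S^n`, its support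
graph is cubic, and exactly one `1`-edge is incident to each node. -/
structure IsCubicPoint (x : Edge V → ℝ) : Prop where
  mem : x ∈ subtourPolytope V
  cubic : (supportGraph x).IsRegularOfDegree 3
  one_edge : ∀ v : V, ∃! e : Edge V, v ∈ (e : Sym2 V) ∧ x e = 1

/-- Boyd-Carr points: the fractional edges form disjoint `4`-cycles. (Every node is incident to
fractional edges here, so all components of the graph of fractional edges are `4`-cycles.) -/
structure IsBoydCarr (x : Edge V → ℝ) : Prop extends IsCubicPoint x where
  squares : ∀ C : (fractionalGraph x).ConnectedComponent,
    Nonempty (C.toSimpleGraph ≃g SimpleGraph.cycleGraph 4)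

/-- Carr-Vempala points: the fractional edges form a Hamiltonian cycle. -/
structure IsCarrVempala (x : Edge V → ℝ) : Prop extends IsCubicPoint x where
  hamiltonian : ∃ (v : V) (p : (fractionalGraph x).Walk v v), p.IsHamiltonianCycle ∧
    ∀ e ∈ (fractionalGraph x).edgeSet, e ∈ p.edges

/-- A fundamental graph: the support graph of a fundamental point, that is, of a Boyd-Carr point
or a Carr-Vempala point. -/
def IsFundamental (G : SimpleGraph V) : Prop :=
  ∃ x : Edge V → ℝ, (IsBoydCarr x ∨ IsCarrVempala x) ∧ supportGraph x = G

end TSP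

end

/-!
Write `F = ∑ v, f v`. Every feasible point `x` of the subtour relaxation has degree `2` at each node
and every pair `uv` costs at least `f u + f v`, so `c x ≥ 2 F`; as `G` is cubic and
`3`-edge-connected, the everywhere `2/3` vector is feasible, so `LP(c)` is an infimum over a nonempty
set and `LP(c) ≥ 2 F` (`two_mul_sum_le_LP`).

*Everywhere vectors.* The everywhere `lam` vector costs `3 * lam * F`. If it is a convex combination
of tours, some tour is no more expensive. A tour contains a closed walk through all nodes
(`IsTour.exists_spanning_closed_walk`, Euler's argument), and as `c` satisfies the triangle
inequality this walk can be shortcut to a Hamiltonian cycle (`exists_isHamiltonianCycle_le`). So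
`OPT(c) ≤ 3 * lam * F ≤ 3 / 2 * lam * LP(c)`.

*Hamiltonian graphs.* A Hamiltonian cycle of `G` itself costs exactly `2 F`, since it passes each
node once (`OPT_le_of_isHamiltonian`). Hence `OPT(c) ≤ LP(c)`, which is more than the bound with
the factor `9 / 7`; no everywhere vector is needed here.

*Fundamental graphs.* The support graph of a Carr-Vempala point contains a Hamiltonian cycle by
definition. For a Boyd-Carr point, the `1`-edges form a perfect matching `τ`, and a perfect matching
`σ` of the `4`-cycles completes it to a `2`-factor. If this `2`-factor is disconnected, some
`4`-cycle meets two of its cycles, and exchanging the two edges of `σ` in this `4`-cycle for the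
other two joins them (`exists_merge`). So a `σ` for which `σ ∪ τ` connects as many pairs of nodes as
possible gives a Hamiltonian cycle (`isHamiltonian_of_squares`).
-/

namespace TSP

open SimpleGraph

section

variable {V : Type*} {G : SimpleGraph V} {f : V → ℝ}

/-! ### Lengths of walks under node weights -/

lemma endSum_nonneg (hf : ∀ v, 0 ≤ f v) (e : Sym2 V) : 0 ≤ endSum f e := by
  induction e with | _ a b => exact add_nonneg (hf a) (hf b)

lemma cost_nonneg (hf : ∀ v, 0 ≤ f v) {u v : V} (p : G.Walk u v) :
    0 ≤ (p.edges.map (endSum f)).sum :=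
  List.sum_nonneg (by simpa using fun e _ => endSum_nonneg hf e)

lemma endSum_le_cost (hf : ∀ v, 0 ≤ f v) {u v : V} (p : G.Walk u v) (huv : u ≠ v) :
    endSum f s(u, v) ≤ (p.edges.map (endSum f)).sum := by
  induction p with
  | nil => exact absurd rfl huv
  | @cons a b c h q ih =>
    simp only [Walk.edges_cons, List.map_cons, List.sum_cons]
    by_cases hbc : b = c
    · subst hbc
      linarith [cost_nonneg hf q]
    · have h1 := ih hbc
      have e1 : endSum f s(b, c) = f b + f c := rfl
      have e2 : endSum f s(a, b) = f a + f b := rfl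
      have e3 : endSum f s(a, c) = f a + f c := rfl
      linarith [hf b]

lemma sum_endSum_edges {u v : V} (p : G.Walk u v) :
    (p.edges.map (endSum f)).sum = 2 * (p.support.tail.map f).sum + f u - f v := by
  induction p with
  | nil => simp
  | @cons a b c h q ih =>
    have : endSum f s(a, b) = f a + f b := rfl
    have hq : (q.support.map f).sum = f b + (q.support.tail.map f).sum := by
      conv_lhs => rw [← q.cons_tail_support]
      rfl
    simp only [Walk.edges_cons, List.map_cons, List.sum_cons, ih, Walk.support_cons,
      List.tail_cons, hq, this]
    ring

lemma shortestPathCost_bddBelow (hf : ∀ v, 0 ≤ f v) (e : Sym2 V) :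
    BddBelow {r | ∃ (u v : V) (p : G.Walk u v), e = s(u, v) ∧ p.IsPath ∧
      r = (p.edges.map (endSum f)).sum} := by
  refine ⟨0, ?_⟩
  rintro r ⟨u, v, p, -, -, rfl⟩
  exact cost_nonneg hf p

lemma everywhereVector_apply (lam : ℝ) (e : Edge V) [Decidable ((e : Sym2 V) ∈ G.edgeSet)] :
    everywhereVector G lam e = if (e : Sym2 V) ∈ G.edgeSet then lam else 0 := by
  unfold everywhereVector
  congr

variable [DecidableEq V]

/-! ### The node-weighted cost is a metric extension -/

/-- The node-weighted cost as a function on all unordered pairs. It vanishes on the diagonal, the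
only path from a node to itself being the trivial one. -/
noncomputable def pairCost (G : SimpleGraph V) (f : V → ℝ) (e : Sym2 V) : ℝ :=
  open Classical in if e ∈ G.edgeSet then endSum f e else shortestPathCost G f e

lemma pairCost_le_cost (hf : ∀ v, 0 ≤ f v) {u v : V} (p : G.Walk u v) :
    pairCost G f s(u, v) ≤ (p.edges.map (endSum f)).sum := by
  unfold pairCost
  split_ifs with h
  · exact endSum_le_cost hf p (G.ne_of_adj h)
  · calc shortestPathCost G f s(u, v) ≤ (p.bypass.edges.map (endSum f)).sum :=
          csInf_le (shortestPathCost_bddBelow hf _) ⟨u, v, _, rfl, p.bypass_isPath, rfl⟩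
      _ ≤ _ := (p.edges_bypass_sublist_edges.map _).sum_le_sum
          (by simpa using fun e _ => endSum_nonneg hf e)

lemma exists_cost_lt (hG : G.Connected) (u v : V) {r : ℝ} (hr : pairCost G f s(u, v) < r) :
    ∃ p : G.Walk u v, (p.edges.map (endSum f)).sum < r := by
  unfold pairCost at hr
  split_ifs at hr with h
  · have hadj : G.Adj u v := h
    exact ⟨Walk.cons hadj .nil, by simpa using hr⟩
  · obtain ⟨p⟩ := hG.preconnected u v
    obtain ⟨_, ⟨a, b, q, he, -, rfl⟩, hq⟩ := exists_lt_of_csInf_lt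
      (by exact ⟨_, u, v, p.bypass, rfl, p.bypass_isPath, rfl⟩) hr
    rcases Sym2.eq_iff.1 he with ⟨rfl, rfl⟩ | ⟨rfl, rfl⟩
    · exact ⟨q, hq⟩
    · exact ⟨q.reverse, by simpa using hq⟩

lemma pairCost_self (hf : ∀ v, 0 ≤ f v) (hG : G.Connected) (u : V) : pairCost G f s(u, u) = 0 := by
  refine le_antisymm (by simpa using pairCost_le_cost hf (Walk.nil : G.Walk u u)) ?_
  by_contra! h
  obtain ⟨p, hp⟩ := exists_cost_lt hG u u h
  exact absurd (cost_nonneg hf p) (not_le.2 hp)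

lemma pairCost_triangle (hf : ∀ v, 0 ≤ f v) (hG : G.Connected) (u v w : V) :
    pairCost G f s(u, w) ≤ pairCost G f s(u, v) + pairCost G f s(v, w) := by
  refine le_of_forall_pos_lt_add fun ε hε => ?_
  obtain ⟨p, hp⟩ := exists_cost_lt (f := f) hG u v (lt_add_of_pos_right _ (half_pos hε))
  obtain ⟨q, hq⟩ := exists_cost_lt (f := f) hG v w (lt_add_of_pos_right _ (half_pos hε))
  have := pairCost_le_cost hf (p.append q)
  simp only [Walk.edges_append, List.map_append, List.sum_append] at this
  linarith

/-- No pair of distinct nodes is cheaper than its two node weights: every path between them pays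
for both of its ends. -/
lemma endSum_le_pairCost (hf : ∀ v, 0 ≤ f v) (hG : G.Connected) {u v : V} (huv : u ≠ v) :
    endSum f s(u, v) ≤ pairCost G f s(u, v) := by
  by_contra! h
  obtain ⟨p, hp⟩ := exists_cost_lt hG u v h
  exact absurd (endSum_le_cost hf p huv) (not_le.2 hp)

lemma pairCost_nonneg (hf : ∀ v, 0 ≤ f v) (hG : G.Connected) (e : Sym2 V) :
    0 ≤ pairCost G f e := by
  induction e with | _ u v =>
  by_contra! h
  obtain ⟨p, hp⟩ := exists_cost_lt hG u v h
  exact absurd (cost_nonneg hf p) (not_le.2 hp)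

lemma endSum_le_nodeWeightedCost (hf : ∀ v, 0 ≤ f v) (hG : G.Connected) (e : Edge V) :
    endSum f e ≤ nodeWeightedCost G f e := by
  obtain ⟨e, he⟩ := e
  induction e with | _ a b => exact endSum_le_pairCost hf hG (by simpa using he)

variable [Fintype V]

/-! ### Cuts, scalar products and walks -/

lemma mem_cut_singleton {v : V} {e : Edge V} : e ∈ cut {v} ↔ v ∈ (e : Sym2 V) := by
  obtain ⟨e, he⟩ := e
  induction e with | _ a b =>
  have hab : a ≠ b := by simpa using he
  simp only [cut, Finset.mem_filter, Finset.mem_univ, true_and, Finset.mem_singleton,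
    exists_eq_left, Sym2.mem_iff]
  constructor
  · rintro ⟨w, -, h⟩
    have : v ∈ s(a, b) := h ▸ Sym2.mem_mk_left v w
    simpa using this
  · rintro (rfl | rfl)
    · exact ⟨b, hab.symm, rfl⟩
    · exact ⟨a, hab, Sym2.eq_swap⟩


lemma endSum_eq_sum (f : V → ℝ) (e : Edge V) :
    endSum f e = ∑ v, if v ∈ (e : Sym2 V) then f v else 0 := by
  obtain ⟨e, he⟩ := e
  induction e with | _ a b =>
  have hab : a ≠ b := by simpa using he
  have : (Finset.univ.filter fun v => v ∈ s(a, b)) = {a, b} := by ext; simp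
  rw [← Finset.sum_filter, this, Finset.sum_pair hab]
  rfl

/-- Double counting: with edge costs `f u + f v`, a vector pays `f v` for every unit of its degree
at `v`. -/
lemma value_endSum (f : V → ℝ) (x : Edge V → ℝ) :
    value (fun e : Edge V => endSum f e) x = ∑ v, f v * ∑ e ∈ cut {v}, x e := by
  have key : ∀ v, (∑ e ∈ cut {v}, x e) = ∑ e : Edge V, if v ∈ (e : Sym2 V) then x e else 0 := by
    intro v
    rw [← Finset.sum_filter]
    refine Finset.sum_congr ?_ fun _ _ => rfl
    ext e
    simp [mem_cut_singleton]
  simp only [value, endSum_eq_sum, key, Finset.mul_sum, Finset.sum_mul]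
  rw [Finset.sum_comm]
  refine Finset.sum_congr rfl fun v _ => Finset.sum_congr rfl fun e _ => ?_
  split_ifs <;> simp

lemma value_mono {c x y : Edge V → ℝ} (hc : ∀ e, 0 ≤ c e) (h : ∀ e, x e ≤ y e) :
    value c x ≤ value c y :=
  Finset.sum_le_sum fun e _ => mul_le_mul_of_nonneg_left (h e) (hc e)

lemma sum_mul_count {R : Type*} [CommSemiring R] (g : Sym2 V → R) :
    ∀ L : List (Sym2 V), (∀ e ∈ L, e ∈ (⊤ : SimpleGraph V).edgeSet) →
      ∑ e : Edge V, g e * (L.count (e : Sym2 V) : R) = (L.map g).sum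
  | [], _ => by simp
  | a :: L, h => by
    have ha := h a (by simp)
    have ih := sum_mul_count g L fun e he => h e (by simp [he])
    have : ∀ e : Edge V, g e * (((a :: L).count (e : Sym2 V) : ℕ) : R)
        = g e * (L.count (e : Sym2 V) : R) + if e = ⟨a, ha⟩ then g a else 0 := by
      intro e
      by_cases hea : e = ⟨a, ha⟩
      · subst hea; simp [mul_add]
      · have : a ≠ (e : Sym2 V) := fun h' => hea (Subtype.ext h'.symm)
        simp [hea, List.count_cons_of_ne this]
    rw [Finset.sum_congr rfl fun e _ => this e, Finset.sum_add_distrib, ih]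
    simp [add_comm]

lemma value_count_edges (g : Sym2 V → ℝ) {u v : V} (p : (⊤ : SimpleGraph V).Walk u v) :
    value (fun e : Edge V => g e) (fun e => (p.edges.count (e : Sym2 V) : ℝ)) =
      (p.edges.map g).sum :=
  sum_mul_count g p.edges fun _ he => p.edges_subset_edgeSet he

/-! ### The value of the subtour relaxation -/

lemma sum_cut_everywhereVector [DecidableRel G.Adj] (lam : ℝ) (v : V) :
    ∑ e ∈ cut {v}, everywhereVector G lam e = G.degree v * lam := by
  classical
  have : ((cut {v}).filter fun e : Edge V => (e : Sym2 V) ∈ G.edgeSet).map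
      (Function.Embedding.subtype _) = G.incidenceFinset v := by
    ext e
    simp only [Finset.mem_map, Finset.mem_filter, mem_cut_singleton,
      Function.Embedding.subtype_apply, mem_incidenceFinset]
    constructor
    · rintro ⟨e, ⟨h1, h2⟩, rfl⟩
      exact ⟨h2, h1⟩
    · rintro ⟨h1, h2⟩
      exact ⟨⟨e, edgeSet_mono le_top h1⟩, ⟨h2, h1⟩, rfl⟩
  simp only [everywhereVector_apply]
  rw [← Finset.sum_filter, Finset.sum_const, ← card_incidenceFinset_eq_degree, ← this,
    Finset.card_map, nsmul_eq_mul]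

/-- In a `3`-edge-connected cubic graph, the everywhere `2/3` vector is feasible for the subtour
relaxation: stars have `3` edges and all other cuts at least `3`. -/
lemma everywhereVector_mem_subtourPolytope [DecidableRel G.Adj] (hconn : G.IsEdgeConnected 3)
    (hG : G.IsRegularOfDegree 3) : everywhereVector G (2 / 3) ∈ subtourPolytope V := by
  classical
  refine ⟨fun v => ?_, fun S ⟨u, hu⟩ hS => ?_, fun e => ?_⟩
  · rw [sum_cut_everywhereVector, hG.degree_eq]; norm_num
  · obtain ⟨v, hv⟩ : ∃ v, v ∉ S := by simpa [Finset.eq_univ_iff_forall] using hS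
    simp only [everywhereVector_apply]
    rw [← Finset.sum_filter, Finset.sum_const, nsmul_eq_mul]
    set D := (cut S).filter fun e : Edge V => (e : Sym2 V) ∈ G.edgeSet with hD
    suffices 3 ≤ D.card by
      have : (3 : ℝ) ≤ D.card := by exact_mod_cast this
      linarith
    by_contra! hlt
    have hcard : (((D.map (Function.Embedding.subtype _) : Finset (Sym2 V)) : Set (Sym2 V))).encard
        < (3 : ℕ) := by
      rw [Set.encard_coe_eq_coe_finsetCard, Finset.card_map]
      exact_mod_cast hlt
    obtain ⟨p⟩ := hconn u v hcard
    obtain ⟨d, -, h1, h2⟩ := p.exists_boundary_dart (S : Set V) hu hv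
    have hadj := d.adj
    rw [deleteEdges_adj] at hadj
    refine hadj.2 ?_
    simp only [Finset.coe_map, Set.mem_image, Finset.mem_coe, hD, Finset.mem_filter, cut,
      Finset.mem_univ, true_and]
    exact ⟨⟨s(d.fst, d.snd), by simp [hadj.1.ne]⟩,
      ⟨⟨_, h1, _, h2, rfl⟩, hadj.1⟩, rfl⟩
  · unfold everywhereVector
    split_ifs <;> norm_num

/-- Every feasible point has degree `2` at each node and so costs at least twice the total node
weight. -/
lemma two_mul_sum_le_LP [DecidableRel G.Adj] [Nonempty V] (hconn : G.IsEdgeConnected 3)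
    (hG : G.IsRegularOfDegree 3) (hf : ∀ v, 0 ≤ f v) :
    2 * ∑ v, f v ≤ LP (nodeWeightedCost G f) := by
  refine le_csInf ⟨_, _, everywhereVector_mem_subtourPolytope hconn hG, rfl⟩ ?_
  rintro _ ⟨x, hx, rfl⟩
  calc 2 * ∑ v, f v = value (fun e : Edge V => endSum f e) x := by
        rw [value_endSum, Finset.mul_sum]
        exact Finset.sum_congr rfl fun v _ => by rw [hx.1 v, mul_comm]
    _ ≤ _ := Finset.sum_le_sum fun e _ => mul_le_mul_of_nonneg_right
        (endSum_le_nodeWeightedCost hf (hconn.connected (by norm_num)) e) (hx.2.2 e).1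

/-! ### Hamiltonian cycles of `G` -/

lemma OPT_le (hf : ∀ v, 0 ≤ f v) (hG : G.Connected) {v : V}
    {p : (⊤ : SimpleGraph V).Walk v v} (hp : p.IsHamiltonianCycle) :
    OPT (nodeWeightedCost G f) ≤ (p.edges.map (pairCost G f)).sum := by
  refine csInf_le ⟨0, ?_⟩ ⟨v, p, hp, (value_count_edges _ p).symm⟩
  rintro _ ⟨_, q, -, rfl⟩
  exact Finset.sum_nonneg fun e _ => mul_nonneg (pairCost_nonneg hf hG e) (Nat.cast_nonneg _)

/-- A Hamiltonian cycle of `G` itself costs exactly twice the total node weight. -/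
lemma OPT_le_of_isHamiltonian (hf : ∀ v, 0 ≤ f v) (hG : G.Connected) {v : V}
    {p : G.Walk v v} (hp : p.IsHamiltonianCycle) :
    OPT (nodeWeightedCost G f) ≤ 2 * ∑ v, f v := by
  have hq : (p.map (Hom.ofLE (le_top : G ≤ ⊤))).IsHamiltonianCycle :=
    hp.map (f := Hom.ofLE (le_top : G ≤ ⊤)) Function.bijective_id
  refine (OPT_le hf hG hq).trans_eq ?_
  have h1 : (p.map (Hom.ofLE (le_top : G ≤ ⊤))).edges = p.edges := Walk.edges_mapLe_eq_edges _ p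
  have h2 : p.edges.map (pairCost G f) = p.edges.map (endSum f) :=
    List.map_congr_left fun e he => if_pos (p.edges_subset_edgeSet he)
  have h3 := (Walk.isHamiltonianCycle_iff_isCycle_and_support_count_tail_eq_one.1 hp).2
  rw [h1, h2, sum_endSum_edges, Finset.sum_list_map_count]
  have h4 : p.support.tail.toFinset = Finset.univ := by
    ext a
    simp [List.count_pos_iff.1 (by rw [h3 a]; norm_num : 0 < p.support.tail.count a)]
  simp [h4, h3]

/-- A Hamiltonian cycle of a cubic graph `G` attains the lower bound for the subtour relaxation, so
that for these costs the bound holds even with the factor `1`. -/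
lemma OPT_le_LP_of_isHamiltonian [Nonempty V] [DecidableRel G.Adj]
    (hconn : G.IsEdgeConnected 3) (hG : G.IsRegularOfDegree 3) (hH : G.IsHamiltonian)
    (hf : ∀ v, 0 ≤ f v) :
    OPT (nodeWeightedCost G f) ≤ 9 / 7 * LP (nodeWeightedCost G f) := by
  have hcard : Fintype.card V ≠ 1 := by
    have := G.degree_lt_card_verts (Classical.arbitrary V)
    rw [hG.degree_eq] at this
    omega
  obtain ⟨v, p, hp⟩ := hH hcard
  have h1 := OPT_le_of_isHamiltonian hf (hconn.connected (by norm_num)) hp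
  have h2 := two_mul_sum_le_LP hconn hG hf
  have h3 : 0 ≤ ∑ v, f v := Finset.sum_nonneg fun v _ => hf v
  linarith

end

section

variable {V : Type*}

/-! ### Shortcutting -/

/-- The cost of visiting the nodes of the list `l` in order, starting from `a`. -/
noncomputable def chainCost (g : Sym2 V → ℝ) : V → List V → ℝ
  | _, [] => 0
  | a, b :: l => g s(a, b) + chainCost g b l

lemma chainCost_tail_support (g : Sym2 V → ℝ) {H : SimpleGraph V} {a b : V} (p : H.Walk a b) :
    chainCost g a p.support.tail = (p.edges.map g).sum := by
  induction p with
  | nil => rfl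
  | @cons a b c h q ih =>
    rw [Walk.support_cons, List.tail_cons, ← q.cons_tail_support, chainCost, ih,
      Walk.edges_cons, List.map_cons, List.sum_cons]

lemma chainCost_append_singleton (g : Sym2 V → ℝ) {H : SimpleGraph V} {a b : V} (p : H.Walk a b)
    (z : V) : chainCost g a (p.support.tail ++ [z]) = (p.edges.map g).sum + g s(b, z) := by
  induction p with
  | nil => simp [chainCost]
  | @cons a b c h q ih =>
    rw [Walk.support_cons, List.tail_cons, ← q.cons_tail_support, List.cons_append, chainCost, ih,
      Walk.edges_cons, List.map_cons, List.sum_cons, add_assoc]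

/-- Under the triangle inequality, skipping intermediate nodes does not raise the cost. -/
lemma chainCost_le_of_sublist {g : Sym2 V → ℝ}
    (htri : ∀ u v w, g s(u, w) ≤ g s(u, v) + g s(v, w)) (z : V) {l l' : List V}
    (h : l'.Sublist l) (a : V) : chainCost g a (l' ++ [z]) ≤ chainCost g a (l ++ [z]) := by
  induction h generalizing a with
  | slnil => rfl
  | @cons l' l b _ ih =>
    have h1 : chainCost g a (l' ++ [z]) ≤ g s(a, b) + chainCost g b (l' ++ [z]) := by
      cases l' with
      | nil => simpa [chainCost] using htri a b z
      | cons c t => simp only [List.cons_append, chainCost]; linarith [htri a b c]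
    simp only [List.cons_append, chainCost]
    linarith [ih b]
  | cons_cons b _ ih =>
    simp only [List.cons_append, chainCost]
    linarith [ih b]

lemma exists_walk_top (z : V) : ∀ (l : List V) (a : V), (a :: (l ++ [z])).Nodup →
    ∃ p : (⊤ : SimpleGraph V).Walk a z, p.support = a :: (l ++ [z])
  | [], a, h => ⟨Walk.cons (by simpa using h) .nil, by simp⟩
  | b :: l, a, h => by
    obtain ⟨q, hq⟩ := exists_walk_top z l b (List.nodup_cons.1 h).2
    have hab : a ≠ b := fun hab => (List.nodup_cons.1 h).1 (by simp [hab])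
    exact ⟨Walk.cons (by simpa using hab) q, by simp [hq]⟩

variable [Fintype V] [DecidableEq V]

/-! ### Closed walks in tours -/

lemma sum_cut_count {v a b : V} (p : (⊤ : SimpleGraph V).Walk a b) :
    ∑ e ∈ cut {v}, p.edges.count (e : Sym2 V) =
      (p.edges.map fun e => if v ∈ e then 1 else 0).sum := by
  have h := sum_mul_count (fun e : Sym2 V => if v ∈ e then 1 else 0) p.edges
    fun _ he => p.edges_subset_edgeSet he
  rw [← h, show cut {v} = Finset.univ.filter fun e : Edge V => v ∈ (e : Sym2 V) by
    ext e; simp [mem_cut_singleton], Finset.sum_filter]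
  simp

/-- A walk has even degree at `v`, except that each of its two ends at `v` changes the parity. -/
lemma even_sum_cut_count {v a b : V} (p : (⊤ : SimpleGraph V).Walk a b) :
    Even ((∑ e ∈ cut {v}, p.edges.count (e : Sym2 V)) + (if v = a then 1 else 0)
      + if v = b then 1 else 0) := by
  rw [sum_cut_count]
  induction p with
  | nil => simp
  | @cons a b c h q ih =>
    have hab : a ≠ b := by simpa using h
    simp only [Walk.edges_cons, List.map_cons, List.sum_cons, Sym2.mem_iff]
    grind

lemma length_le_of_count_le {m : Edge V → ℕ} {a b : V} (p : (⊤ : SimpleGraph V).Walk a b)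
    (hp : ∀ e : Edge V, p.edges.count (e : Sym2 V) ≤ m e) : p.length ≤ ∑ e, m e := by
  have h := sum_mul_count (fun _ : Sym2 V => 1) p.edges fun _ he => p.edges_subset_edgeSet he
  simp only [one_mul, Nat.cast_id, List.map_const', List.sum_replicate, Walk.length_edges,
    smul_eq_mul, mul_one] at h
  rw [← h]
  exact Finset.sum_le_sum fun e _ => hp e

/-- Following unused edges, one is only stuck at the starting node. -/
lemma exists_closed_walk_le {m : Edge V → ℕ} (hm : ∀ v : V, Even (∑ e ∈ cut {v}, m e))
    {u w : V} (huw : (⊤ : SimpleGraph V).Adj u w) (hpos : 0 < m ⟨s(u, w), huw⟩) :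
    ∃ p : (⊤ : SimpleGraph V).Walk u u, 0 < p.length ∧
      ∀ e : Edge V, p.edges.count (e : Sym2 V) ≤ m e := by
  classical
  let P : ℕ → Prop := fun n => ∃ (b : V) (p : (⊤ : SimpleGraph V).Walk u b),
    p.length = n ∧ ∀ e : Edge V, p.edges.count (e : Sym2 V) ≤ m e
  have hbound : ∀ n, P n → n ≤ ∑ e, m e := by
    rintro n ⟨b, p, rfl, hp⟩
    exact length_le_of_count_le p hp
  have h1 : P 1 := by
    refine ⟨w, Walk.cons huw .nil, by simp, fun e => ?_⟩
    by_cases he : s(u, w) = e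
    · obtain rfl : e = ⟨s(u, w), huw⟩ := Subtype.ext he.symm
      simpa using Nat.succ_le_of_lt hpos
    · simp [List.count_cons_of_ne he]
  obtain ⟨b, p, hlen, hp⟩ := Nat.findGreatest_spec (P := P) (hbound 1 h1) h1
  have hmax := fun k hk => Nat.le_findGreatest (P := P) (hbound k hk) hk
  by_cases hub : b = u
  · subst hub
    exact ⟨p, by have := hmax 1 h1; omega, hp⟩
  exfalso
  obtain ⟨e, he, hlt⟩ : ∃ e ∈ cut {b}, p.edges.count (e : Sym2 V) < m e := by
    by_contra! hcon
    have heq := Finset.sum_congr rfl fun e he => le_antisymm (hp e) (hcon e he)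
    have := even_sum_cut_count (v := b) p
    rw [heq] at this
    simp only [hub, if_false, if_true] at this
    exact (Nat.even_add_one.1 this) (hm b)
  rw [mem_cut_singleton] at he
  obtain ⟨e, hE⟩ := e
  obtain ⟨c, rfl⟩ := Sym2.mem_iff_exists.1 he
  have hbc : (⊤ : SimpleGraph V).Adj b c := hE
  have : P (p.length + 1) := by
    refine ⟨c, p.concat hbc, by simp, fun e => ?_⟩
    rw [Walk.edges_concat, List.concat_eq_append, List.count_append]
    by_cases he : s(b, c) = e
    · obtain rfl : e = ⟨s(b, c), hE⟩ := Subtype.ext he.symm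
      simpa using hlt
    · simpa [List.count_cons_of_ne he] using hp e
  have := hmax _ this
  omega

/-- Every tour contains a closed walk through all nodes: a longest closed walk in the tour misses
no node, since a closed walk in the remaining edges could be spliced into it otherwise. -/
lemma IsTour.exists_spanning_closed_walk {m : Edge V → ℕ} (hm : IsTour m) :
    ∃ (u : V) (p : (⊤ : SimpleGraph V).Walk u u),
      (∀ e : Edge V, p.edges.count (e : Sym2 V) ≤ m e) ∧ ∀ v, v ∈ p.support := by
  classical
  let P : ℕ → Prop := fun n => ∃ (u : V) (p : (⊤ : SimpleGraph V).Walk u u),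
    p.length = n ∧ ∀ e : Edge V, p.edges.count (e : Sym2 V) ≤ m e
  have hbound : ∀ n, P n → n ≤ ∑ e, m e := by
    rintro n ⟨b, p, rfl, hp⟩
    exact length_le_of_count_le p hp
  have h0 : P 0 := ⟨hm.connected.nonempty.some, .nil, rfl, by simp⟩
  obtain ⟨u, p, hlen, hp⟩ := Nat.findGreatest_spec (P := P) (hbound 0 h0) h0
  have hmax := fun k hk => Nat.le_findGreatest (P := P) (hbound k hk) hk
  refine ⟨u, p, hp, fun v => ?_⟩
  by_contra hv
  obtain ⟨q⟩ := hm.connected.preconnected u v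
  obtain ⟨d, -, hx, hy⟩ := q.exists_boundary_dart {z | z ∈ p.support} p.start_mem_support hv
  have hd := d.adj
  simp only [fromEdgeSet_adj, Set.mem_ofPred_eq] at hd
  obtain ⟨⟨⟨e, hE⟩, he, hpos⟩, hne⟩ := hd
  dsimp only at he
  subst he
  have hy' : p.edges.count s(d.fst, d.snd) = 0 :=
    List.count_eq_zero.2 fun h => hy (p.snd_mem_support_of_mem_edges h)
  obtain ⟨r, hr, hrm⟩ := exists_closed_walk_le (u := d.fst) (w := d.snd)
    (m := fun e => m e - p.edges.count (e : Sym2 V)) (fun v => by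
      have h1 := even_sum_cut_count (v := v) p
      have h2 := hm.even_degree v
      have h3 : ∑ e ∈ cut {v}, m e = ∑ e ∈ cut {v}, (m e - p.edges.count (e : Sym2 V))
          + ∑ e ∈ cut {v}, p.edges.count (e : Sym2 V) := by
        rw [← Finset.sum_add_distrib]
        exact Finset.sum_congr rfl fun e _ => (Nat.sub_add_cancel (hp e)).symm
      rw [h3] at h2
      grind) hE (by simpa [hy'] using hpos)
  have : P (p.length + r.length) := by
    refine ⟨d.fst, (p.rotate d.fst hx).append r, ?_, fun e => ?_⟩
    · have := (p.rotate_edges d.fst hx).perm.length_eq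
      simp only [Walk.length_edges] at this
      rw [Walk.length_append, this]
    · rw [Walk.edges_append, List.count_append, (p.rotate_edges d.fst hx).perm.count_eq]
      have := hrm e
      have := hp e
      omega
  have := hmax _ this
  omega

/-- A closed walk through all nodes can be shortcut to a Hamiltonian cycle which is not more
expensive: keep one visit of each node. -/
lemma exists_isHamiltonianCycle_le {g : Sym2 V → ℝ}
    (htri : ∀ u v w, g s(u, w) ≤ g s(u, v) + g s(v, w)) (hself : ∀ u, g s(u, u) = 0)
    (hcard : 3 ≤ Fintype.card V) {u : V} (p : (⊤ : SimpleGraph V).Walk u u)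
    (hp : ∀ v, v ∈ p.support) :
    ∃ q : (⊤ : SimpleGraph V).Walk u u, q.IsHamiltonianCycle ∧
      (q.edges.map g).sum ≤ (p.edges.map g).sum := by
  set l := (p.support.tail.filter (· ≠ u)).dedup with hl
  have hsub : l.Sublist p.support.tail := (List.dedup_sublist _).trans List.filter_sublist
  have hul : u ∉ l := by simp [hl]
  have hnd : (l ++ [u]).Nodup := by
    rw [List.nodup_append]
    exact ⟨List.nodup_dedup _, by simp, by grind⟩
  have hmem : ∀ v, v ∈ l ++ [u] := by
    intro v
    have := hp v
    rw [← p.cons_tail_support, List.mem_cons] at this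
    by_cases hv : v = u
    · simp [hv]
    · simp [hl, hv, this.resolve_left hv]
  have hlen : (l ++ [u]).length = Fintype.card V := by
    rw [← List.toFinset_card_of_nodup hnd, ← Finset.card_univ]
    congr 1
    ext v
    simpa [or_comm] using hmem v
  obtain ⟨b, t, hbt⟩ : ∃ b t, l = b :: t := by
    cases h : l with
    | nil => simp [h] at hlen; omega
    | cons b t => exact ⟨b, t, rfl⟩
  rw [hbt] at hnd hlen
  obtain ⟨r, hr⟩ := exists_walk_top u t b (by simpa using hnd)
  have hub : (⊤ : SimpleGraph V).Adj u b := by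
    rintro rfl
    exact hul (by simp [hbt])
  refine ⟨Walk.cons hub r, ?_, ?_⟩
  · have hrlen : r.length + 1 = Fintype.card V := by
      rw [← Walk.length_support, hr, ← hlen]; simp
    rw [Walk.isHamiltonianCycle_iff_isCycle_and_length_eq,
      Walk.isCycle_iff_isPath_tail_and_le_length]
    refine ⟨⟨?_, by simp; omega⟩, by simpa using hrlen⟩
    have : r.IsPath := by
      rw [Walk.isPath_def, hr]
      simpa using hnd
    simpa using this
  · rw [← chainCost_tail_support, Walk.support_cons, List.tail_cons, hr, ← List.cons_append, ← hbt]
    refine (chainCost_le_of_sublist htri u hsub u).trans_eq ?_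
    rw [chainCost_append_singleton, hself, add_zero]

/-! ### The cost of tours -/

variable {G : SimpleGraph V} {f : V → ℝ}

/-- The cost of a tour bounds the cost of an optimal Hamiltonian cycle. -/
lemma OPT_le_value_of_isTour (hf : ∀ v, 0 ≤ f v) (hG : G.Connected) (hcard : 3 ≤ Fintype.card V)
    {m : Edge V → ℕ} (hm : IsTour m) :
    OPT (nodeWeightedCost G f) ≤ value (nodeWeightedCost G f) fun e => (m e : ℝ) := by
  obtain ⟨u, p, hpm, hp⟩ := hm.exists_spanning_closed_walk
  obtain ⟨q, hq, hqp⟩ := exists_isHamiltonianCycle_le (pairCost_triangle hf hG)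
    (pairCost_self hf hG) hcard p hp
  calc OPT (nodeWeightedCost G f) ≤ _ := OPT_le hf hG hq
    _ ≤ _ := hqp
    _ = value (nodeWeightedCost G f) fun e => (p.edges.count (e : Sym2 V) : ℝ) :=
      (value_count_edges _ p).symm
    _ ≤ _ := value_mono (fun e => pairCost_nonneg hf hG e) fun e => by exact_mod_cast hpm e

lemma OPT_le_value_of_mem_tourPolyhedron (hf : ∀ v, 0 ≤ f v) (hG : G.Connected)
    (hcard : 3 ≤ Fintype.card V) {y : Edge V → ℝ} (hy : y ∈ tourPolyhedron V) :
    OPT (nodeWeightedCost G f) ≤ value (nodeWeightedCost G f) y := by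
  have hconv : Convex ℝ {x | OPT (nodeWeightedCost G f) ≤ value (nodeWeightedCost G f) x} :=
    convex_halfSpace_ge (f := value (nodeWeightedCost G f))
      ⟨fun x y => by simp [value, mul_add, Finset.sum_add_distrib],
      fun a x => by simp [value, Finset.mul_sum, mul_left_comm]⟩ _
  refine convexHull_min ?_ hconv hy
  rintro _ ⟨m, hm, rfl⟩
  exact OPT_le_value_of_isTour hf hG hcard hm

lemma nonneg_of_mem_tourPolyhedron {y : Edge V → ℝ} (hy : y ∈ tourPolyhedron V)
    (e : Edge V) : 0 ≤ y e := by
  have hconv : Convex ℝ {x : Edge V → ℝ | 0 ≤ x e} :=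
    fun a ha b hb s t hs ht _ => add_nonneg (mul_nonneg hs ha) (mul_nonneg ht hb)
  refine convexHull_min ?_ hconv hy
  rintro _ ⟨m, -, rfl⟩
  exact Nat.cast_nonneg (α := ℝ) (m e)

/-- The everywhere `lam` vector has degree `3 * lam` at each node and so costs `3 * lam` times the
total node weight, against at least `2` times that weight for the subtour relaxation. -/
lemma OPT_le_of_everywhereVector_mem [Nonempty V] [DecidableRel G.Adj]
    (hconn : G.IsEdgeConnected 3) (hG : G.IsRegularOfDegree 3) (hf : ∀ v, 0 ≤ f v) {lam : ℝ}
    (hlam : everywhereVector G lam ∈ tourPolyhedron V) :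
    OPT (nodeWeightedCost G f) ≤ 3 / 2 * lam * LP (nodeWeightedCost G f) := by
  have hC : G.Connected := hconn.connected (by norm_num)
  obtain ⟨v⟩ := ‹Nonempty V›
  have hcard : 3 ≤ Fintype.card V := by
    have := G.degree_lt_card_verts v
    rw [hG.degree_eq] at this
    omega
  have hlam0 : 0 ≤ lam := by
    have h : 0 ≤ ∑ e ∈ cut {v}, everywhereVector G lam e :=
      Finset.sum_nonneg fun e _ => nonneg_of_mem_tourPolyhedron hlam e
    rw [sum_cut_everywhereVector, hG.degree_eq] at h
    norm_num at h
    exact h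
  have hval : value (nodeWeightedCost G f) (everywhereVector G lam) = 3 * lam * ∑ v, f v := by
    have : value (nodeWeightedCost G f) (everywhereVector G lam)
        = value (fun e : Edge V => endSum f e) (everywhereVector G lam) := by
      refine Finset.sum_congr rfl fun e _ => ?_
      by_cases he : (e : Sym2 V) ∈ G.edgeSet
      · rw [show nodeWeightedCost G f e = endSum f e from if_pos he]
      · simp [everywhereVector_apply, he]
    rw [this, value_endSum, Finset.mul_sum]
    refine Finset.sum_congr rfl fun v _ => ?_
    rw [sum_cut_everywhereVector, hG.degree_eq]
    push_cast
    ring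
  calc _ ≤ _ := OPT_le_value_of_mem_tourPolyhedron hf hC hcard hlam
    _ = 3 / 2 * lam * (2 * ∑ v, f v) := by rw [hval]; ring
    _ ≤ _ := by
      have := Nonempty.intro v
      exact mul_le_mul_of_nonneg_left (two_mul_sum_le_LP hconn hG hf) (by linarith)

end

section

variable {V : Type*}

/-! ### Fundamental graphs are Hamiltonian -/

/-- The union of the two perfect matchings given by fixed-point-free involutions `σ` and `τ`. -/
def matchingUnion (σ τ : V → V) : SimpleGraph V :=
  SimpleGraph.fromRel fun x y => y = σ x ∨ y = τ x

lemma matchingUnion_adj {σ τ : V → V} (hσ : Function.Involutive σ) (hτ : Function.Involutive τ)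
    (hσ' : ∀ v, σ v ≠ v) (hτ' : ∀ v, τ v ≠ v) {x y : V} :
    (matchingUnion σ τ).Adj x y ↔ y = σ x ∨ y = τ x := by
  simp only [matchingUnion, fromRel_adj]
  have h1 := hσ y
  have h2 := hτ y
  have h3 := hσ' x
  have h4 := hτ' x
  grind

lemma isCycles_matchingUnion {σ τ : V → V} (hσ : Function.Involutive σ)
    (hτ : Function.Involutive τ) (hσ' : ∀ v, σ v ≠ v) (hτ' : ∀ v, τ v ≠ v)
    (hne : ∀ v, σ v ≠ τ v) : (matchingUnion σ τ).IsCycles := by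
  intro v _
  have : (matchingUnion σ τ).neighborSet v = {σ v, τ v} := by
    ext w
    simp [matchingUnion_adj hσ hτ hσ' hτ']
  rw [this, Set.ncard_pair (hne v)]

/-- A connected graph in which every node has exactly two neighbors is a Hamiltonian cycle. -/
lemma isHamiltonian_of_isCycles [Nonempty V] [Fintype V] [DecidableEq V] {F : SimpleGraph V}
    (hF : F.Preconnected) (hcyc : F.IsCycles) (hne : ∀ v, (F.neighborSet v).Nonempty) :
    F.IsHamiltonian := by
  intro _
  obtain ⟨v⟩ := ‹Nonempty V›
  obtain ⟨p, hp, hverts⟩ := hcyc.exists_cycle_toSubgraph_verts_eq_connectedComponentSupp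
    (c := F.connectedComponentMk v) rfl (hne v)
  refine ⟨v, p, Walk.isHamiltonianCycle_iff_isCycle_and_support_count_tail_eq_one.2
    ⟨hp, fun w => List.count_eq_one_of_mem hp.support_nodup ?_⟩⟩
  have hw : w ∈ p.toSubgraph.verts := by
    rw [hverts]
    exact ConnectedComponent.sound (hF w v)
  rw [Walk.mem_verts_toSubgraph, ← p.cons_tail_support, List.mem_cons] at hw
  rcases hw with rfl | hw
  · exact Walk.end_mem_tail_support hp.not_nil
  · exact hw

lemma reachable_of_forall_adj {F F' : SimpleGraph V}
    (h : ∀ x y, F.Adj x y → F'.Reachable x y) {x y : V} (hxy : F.Reachable x y) :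
    F'.Reachable x y := by
  obtain ⟨p⟩ := hxy
  induction p with
  | nil => rfl
  | cons hadj _ ih => exact (h _ _ hadj).trans ih

variable {Q : SimpleGraph V}

/-- Every edge `uv` of a disjoint union of `4`-cycles lies in a `4`-cycle `u v w z`, and `u` and `v`
have no other neighbors than on this cycle. -/
lemma exists_square (hQ : ∀ C : Q.ConnectedComponent, Nonempty (C.toSimpleGraph ≃g cycleGraph 4))
    {u v : V} (huv : Q.Adj u v) :
    ∃ w z, Q.Adj w z ∧ (∀ x, Q.Adj u x → x = v ∨ x = z) ∧ ∀ x, Q.Adj v x → x = u ∨ x = w := by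
  obtain ⟨φ⟩ := hQ (Q.connectedComponentMk u)
  have hmem : ∀ x, Q.Reachable x u → x ∈ (Q.connectedComponentMk u).supp :=
    fun x hx => ConnectedComponent.sound hx
  have hcyc : ∀ i j : Fin 4, (cycleGraph 4).Adj i j → ∃ k l, (cycleGraph 4).Adj k l ∧
      (∀ x, (cycleGraph 4).Adj i x → x = j ∨ x = l) ∧
      ∀ x, (cycleGraph 4).Adj j x → x = i ∨ x = k := by decide
  set u' : Q.connectedComponentMk u := ⟨u, hmem u .rfl⟩ with hu'
  set v' : Q.connectedComponentMk u := ⟨v, hmem v huv.symm.reachable⟩ with hv'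
  have huv' : (Q.connectedComponentMk u).toSimpleGraph.Adj u' v' := huv
  obtain ⟨k, l, h1, h2, h3⟩ := hcyc _ _ (φ.map_adj_iff.2 huv')
  obtain ⟨w, rfl⟩ := φ.surjective k
  obtain ⟨z, rfl⟩ := φ.surjective l
  refine ⟨w.1, z.1, φ.map_adj_iff.1 h1, fun x hx => ?_, fun x hx => ?_⟩
  · have hx' : (Q.connectedComponentMk u).toSimpleGraph.Adj u' ⟨x, hmem x hx.symm.reachable⟩ := hx
    rcases h2 _ (φ.map_adj_iff.2 hx') with h | h
    · exact .inl (congrArg Subtype.val (φ.injective h))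
    · exact .inr (congrArg Subtype.val (φ.injective h))
  · have hx' : (Q.connectedComponentMk u).toSimpleGraph.Adj v'
        ⟨x, hmem x (hx.symm.reachable.trans huv.symm.reachable)⟩ := hx
    rcases h3 _ (φ.map_adj_iff.2 hx') with h | h
    · exact .inl (congrArg Subtype.val (φ.injective h))
    · exact .inr (congrArg Subtype.val (φ.injective h))

/-- A disjoint union of `4`-cycles has a perfect matching, encoded as an involution. -/
lemma exists_matching_of_squares
    (hQ : ∀ C : Q.ConnectedComponent, Nonempty (C.toSimpleGraph ≃g cycleGraph 4)) :
    ∃ σ : V → V, Function.Involutive σ ∧ ∀ v, Q.Adj v (σ v) := by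
  let φ := fun C => (hQ C).some
  let flip : Fin 4 → Fin 4 := ![1, 0, 3, 2]
  have hflip : ∀ i, flip (flip i) = i := by decide
  have hadj : ∀ i, (cycleGraph 4).Adj i (flip i) := by decide
  let ρ : ∀ C : Q.ConnectedComponent, C → C := fun C v => (φ C).symm (flip (φ C v))
  have hρ : ∀ (C : Q.ConnectedComponent) (v : C), ρ C (ρ C v) = v := by simp [ρ, hflip]
  let σ : V → V := fun v => ρ (Q.connectedComponentMk v) ⟨v, rfl⟩
  have hσ : ∀ (C : Q.ConnectedComponent) (v : C), σ v = ρ C v := by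
    rintro C ⟨v, hv⟩
    obtain rfl : Q.connectedComponentMk v = C := hv
    rfl
  refine ⟨σ, fun v => ?_, fun v => ?_⟩
  · exact (hσ _ (ρ (Q.connectedComponentMk v) ⟨v, rfl⟩)).trans (congrArg Subtype.val (hρ _ _))
  · have : (Q.connectedComponentMk v).toSimpleGraph.Adj ⟨v, rfl⟩ (ρ _ ⟨v, rfl⟩) := by
      rw [← (φ (Q.connectedComponentMk v)).map_adj_iff]
      simpa [ρ] using hadj _
    exact this

/-- Let `τ` and `σ` be perfect matchings and let `u v w z` be a `4`-cycle with the edges `zu` and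
`vw` in `σ`. If `u` and `v` lie on different cycles of `σ ∪ τ`, exchanging the edges `zu` and `vw`
of `σ` for `uv` and `wz` joins these two cycles and separates no nodes. -/
lemma exists_merge [Finite V] {σ τ : V → V} (hσ : Function.Involutive σ)
    (hτ : Function.Involutive τ) (hτQ : ∀ v, ¬ Q.Adj v (τ v)) (hτ' : ∀ v, τ v ≠ v)
    (hσQ : ∀ v, Q.Adj v (σ v)) {u v : V} (huv : Q.Adj u v) (hwz : Q.Adj (σ v) (σ u))
    (hnot : ¬ (matchingUnion σ τ).Reachable u v) :
    ∃ σ' : V → V, Function.Involutive σ' ∧ (∀ v, Q.Adj v (σ' v)) ∧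
      (∀ x y, (matchingUnion σ τ).Reachable x y → (matchingUnion σ' τ).Reachable x y) ∧
      (matchingUnion σ' τ).Reachable u v := by
  classical
  have hσ' : ∀ v, σ v ≠ v := fun v => (hσQ v).ne'
  have hadj := fun {x y : V} => matchingUnion_adj hσ hτ hσ' hτ' (x := x) (y := y)
  have hzu : (matchingUnion σ τ).Adj u (σ u) := hadj.2 (.inl rfl)
  have hvw : (matchingUnion σ τ).Adj v (σ v) := hadj.2 (.inl rfl)
  have hcyc := isCycles_matchingUnion hσ hτ hσ' hτ' fun v h => hτQ v (h ▸ hσQ v)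
  obtain ⟨w, hw⟩ : ∃ w, w = σ v := ⟨_, rfl⟩
  obtain ⟨z, hz⟩ : ∃ z, z = σ u := ⟨_, rfl⟩
  rw [← hw] at hvw hwz
  rw [← hz] at hzu hwz
  have hw' : σ w = v := by rw [hw, hσ]
  have hz' : σ z = u := by rw [hz, hσ]
  have huw : u ≠ w := fun h => hnot (h ▸ hvw.symm.reachable)
  have hvz : v ≠ z := fun h => hnot (h ▸ hzu.reachable)
  have huv' := huv.ne
  have hwz' := hwz.ne
  have hzu' := hzu.ne
  have hvw' := hvw.ne
  set σ' : V → V := fun x => if x = u then v else if x = v then u else if x = w then z else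
    if x = z then w else σ x with hσ'def
  have hinv : Function.Involutive σ' := by
    intro x
    have := hσ x
    simp only [hσ'def]
    grind
  have hQ' : ∀ x, Q.Adj x (σ' x) := by
    intro x
    simp only [hσ'def]
    split_ifs with h1 h2 h3 h4
    · exact h1 ▸ huv
    · exact h2 ▸ huv.symm
    · exact h3 ▸ hwz
    · exact h4 ▸ hwz.symm
    · exact hσQ x
  have hadj' := fun {x y : V} =>
    matchingUnion_adj hinv hτ (fun v => (hQ' v).ne') hτ' (x := x) (y := y)
  -- The rest of the cycle through an edge `ab` still joins `a` to `b`.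
  have hkey : ∀ a b, (matchingUnion σ τ).Adj a b → (∀ x y, (matchingUnion σ τ).Reachable a x →
      (matchingUnion σ τ).Adj x y → s(x, y) ≠ s(a, b) → (matchingUnion σ' τ).Adj x y) →
      (matchingUnion σ' τ).Reachable a b := by
    intro a b hab h
    obtain ⟨p⟩ := hcyc.reachable_deleteEdges hab
    refine ⟨p.transfer _ fun e he => ?_⟩
    induction e with | _ x y =>
    have hxy := p.adj_of_mem_edges he
    rw [deleteEdges_adj] at hxy
    exact h x y (((p.takeUntil x (p.fst_mem_support_of_mem_edges he)).reachable).mono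
      (deleteEdges_le _)) hxy.1 hxy.2
  have hruz : (matchingUnion σ' τ).Reachable u z := by
    refine hkey u z hzu fun x y hx hxy hne => ?_
    have hxv : x ≠ v := fun h => hnot (h ▸ hx)
    have hxw : x ≠ w := fun h => hnot ((h ▸ hx).trans hvw.symm.reachable)
    rw [hadj] at hxy
    rw [hadj']
    refine hxy.imp_left fun h => ?_
    have hxu : x ≠ u := by
      rintro rfl
      exact hne (by rw [h, hz])
    have hxz : x ≠ z := by
      rintro rfl
      exact hne (by rw [h, hz', Sym2.eq_swap])
    simp [hσ'def, hxu, hxv, hxw, hxz, h]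
  have hrvw : (matchingUnion σ' τ).Reachable v w := by
    refine hkey v w hvw fun x y hx hxy hne => ?_
    have hxu : x ≠ u := fun h => hnot (h ▸ hx).symm
    have hxz : x ≠ z := fun h => hnot (hzu.reachable.trans (h ▸ hx).symm)
    rw [hadj] at hxy
    rw [hadj']
    refine hxy.imp_left fun h => ?_
    have hxv : x ≠ v := by
      rintro rfl
      exact hne (by rw [h, hw])
    have hxw : x ≠ w := by
      rintro rfl
      exact hne (by rw [h, hw', Sym2.eq_swap])
    simp [hσ'def, hxu, hxv, hxw, hxz, h]
  refine ⟨σ', hinv, hQ', fun x y => reachable_of_forall_adj fun x y hxy => ?_,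
    (hadj'.2 (.inl (by simp [hσ'def]))).reachable⟩
  rcases hadj.1 hxy with h | h
  · by_cases hxu : x = u
    · rw [h, hxu, ← hz]; exact hruz
    by_cases hxv : x = v
    · rw [h, hxv, ← hw]; exact hrvw
    by_cases hxw : x = w
    · rw [h, hxw, hw']; exact hrvw.symm
    by_cases hxz : x = z
    · rw [h, hxz, hz']; exact hruz.symm
    exact (hadj'.2 (.inl (by simp [hσ'def, hxu, hxv, hxw, hxz, h]))).reachable
  · exact (hadj'.2 (.inr h)).reachable

/-- A connected graph composed of a perfect matching `τ` and of disjoint `4`-cycles `Q` covering all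
nodes is Hamiltonian: among the perfect matchings `σ` of `Q`, one for which `σ ∪ τ` connects as many
pairs as possible makes `σ ∪ τ` a Hamiltonian cycle. -/
lemma isHamiltonian_of_squares [Nonempty V] [Fintype V] [DecidableEq V] {G : SimpleGraph V}
    (hG : G.Preconnected) (hQG : Q ≤ G)
    (hQ : ∀ C : Q.ConnectedComponent, Nonempty (C.toSimpleGraph ≃g cycleGraph 4))
    {τ : V → V} (hτ : Function.Involutive τ) (hτG : ∀ v, G.Adj v (τ v))
    (hτQ : ∀ v, ¬ Q.Adj v (τ v)) (hcover : ∀ u v, G.Adj u v → Q.Adj u v ∨ v = τ u) :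
    G.IsHamiltonian := by
  have hτ' : ∀ v, τ v ≠ v := fun v => (hτG v).ne'
  obtain ⟨σ₀, hσ₀⟩ := exists_matching_of_squares hQ
  let S := {σ : V → V // Function.Involutive σ ∧ ∀ v, Q.Adj v (σ v)}
  have : Nonempty S := ⟨⟨σ₀, hσ₀⟩⟩
  obtain ⟨⟨σ, hσ, hσQ⟩, hmax⟩ := Finite.exists_max fun σ : S =>
    {q : V × V | (matchingUnion σ.1 τ).Reachable q.1 q.2}.ncard
  have hσ' : ∀ v, σ v ≠ v := fun v => (hσQ v).ne'
  have hadj := fun {x y : V} => matchingUnion_adj hσ hτ hσ' hτ' (x := x) (y := y)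
  have hconn : (matchingUnion σ τ).Preconnected := by
    intro a b
    by_contra hab
    obtain ⟨p⟩ := hG a b
    obtain ⟨d, -, hu, hv⟩ :=
      p.exists_boundary_dart {x | (matchingUnion σ τ).Reachable a x} .rfl hab
    obtain ⟨⟨u, v⟩, hd⟩ := d
    have hnot : ¬ (matchingUnion σ τ).Reachable u v := fun h => hv (Reachable.trans hu h)
    have huv : Q.Adj u v := (hcover u v hd).resolve_right fun h =>
      hnot (hadj.2 (.inr h)).reachable
    obtain ⟨w, z, hwz, hnu, hnv⟩ := exists_square hQ huv
    have hz : σ u = z := (hnu _ (hσQ u)).resolve_left fun h =>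
      hnot (hadj.2 (.inl h.symm)).reachable
    have hw : σ v = w := (hnv _ (hσQ v)).resolve_left fun h =>
      hnot (hadj.2 (.inl h.symm)).symm.reachable
    obtain ⟨σ', h1, h2, h3, h4⟩ := exists_merge hσ hτ hτQ hτ' hσQ huv (by rwa [hz, hw]) hnot
    refine absurd (hmax ⟨σ', h1, h2⟩) (not_le.2 (Set.ncard_lt_ncard ?_))
    exact ⟨fun q hq => h3 _ _ hq, fun h => hnot (h (show (u, v) ∈ _ from h4))⟩
  have hHam := isHamiltonian_of_isCycles hconn
    (isCycles_matchingUnion hσ hτ hσ' hτ' fun v h => hτQ v (h ▸ hσQ v))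
    fun v => ⟨σ v, hadj.2 (.inl rfl)⟩
  refine hHam.mono fun x y hxy => ?_
  rcases hadj.1 hxy with rfl | rfl
  · exact hQG (hσQ x)
  · exact hτG x

variable {x : Edge V → ℝ}

lemma supportGraph_adj {u v : V} :
    (supportGraph x).Adj u v ↔ ∃ h : (⊤ : SimpleGraph V).Adj u v, 0 < x ⟨s(u, v), h⟩ := by
  simp only [supportGraph, fromEdgeSet_adj, Set.mem_ofPred_eq]
  constructor
  · rintro ⟨⟨⟨e, he⟩, rfl, h⟩, -⟩
    exact ⟨he, h⟩
  · rintro ⟨h, hx⟩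
    exact ⟨⟨_, rfl, hx⟩, h.ne⟩

lemma fractionalGraph_adj {u v : V} :
    (fractionalGraph x).Adj u v ↔
      ∃ h : (⊤ : SimpleGraph V).Adj u v, 0 < x ⟨s(u, v), h⟩ ∧ x ⟨s(u, v), h⟩ < 1 := by
  simp only [fractionalGraph, fromEdgeSet_adj, Set.mem_ofPred_eq]
  constructor
  · rintro ⟨⟨⟨e, he⟩, rfl, h⟩, -⟩
    exact ⟨he, h⟩
  · rintro ⟨h, hx⟩
    exact ⟨⟨_, rfl, hx⟩, h.ne⟩

lemma fractionalGraph_le : fractionalGraph x ≤ supportGraph x := fun _ _ h => by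
  obtain ⟨h, hx, -⟩ := fractionalGraph_adj.1 h
  exact supportGraph_adj.2 ⟨h, hx⟩

variable [Fintype V] [DecidableEq V]

/-- The `1`-edges of a cubic point form a perfect matching. -/
lemma IsCubicPoint.exists_matching (hx : IsCubicPoint x) : ∃ τ : V → V, Function.Involutive τ ∧
    (∀ v, ∃ h : (⊤ : SimpleGraph V).Adj v (τ v), x ⟨s(v, τ v), h⟩ = 1) ∧
    ∀ v w (h : (⊤ : SimpleGraph V).Adj v w), x ⟨s(v, w), h⟩ = 1 → w = τ v := by
  have hex : ∀ v, ∃ w, (∃ h : (⊤ : SimpleGraph V).Adj v w, x ⟨s(v, w), h⟩ = 1) ∧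
      ∀ w' (h : (⊤ : SimpleGraph V).Adj v w'), x ⟨s(v, w'), h⟩ = 1 → w' = w := by
    intro v
    obtain ⟨⟨e, he⟩, ⟨hv, h1⟩, huniq⟩ := hx.one_edge v
    obtain ⟨w, rfl⟩ := Sym2.mem_iff_exists.1 hv
    refine ⟨w, ⟨he, h1⟩, fun w' h h' => ?_⟩
    have := congrArg Subtype.val (huniq ⟨s(v, w'), h⟩ ⟨Sym2.mem_mk_left _ _, h'⟩)
    exact Sym2.congr_right.1 this
  choose τ hτ huniq using hex
  refine ⟨τ, fun v => (huniq (τ v) v (hτ v).1.symm ?_).symm, hτ, huniq⟩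
  exact (congrArg x (Subtype.ext Sym2.eq_swap)).trans (hτ v).2

lemma IsBoydCarr.isHamiltonian [Nonempty V] (hx : IsBoydCarr x)
    (hconn : (supportGraph x).Preconnected) :
    (supportGraph x).IsHamiltonian := by
  obtain ⟨τ, hτ, h1, huniq⟩ := hx.exists_matching
  refine isHamiltonian_of_squares hconn fractionalGraph_le hx.squares hτ (fun v => ?_)
    (fun v hv => ?_) fun u v huv => ?_
  · obtain ⟨h, hv⟩ := h1 v
    exact supportGraph_adj.2 ⟨h, by rw [hv]; norm_num⟩
  · obtain ⟨_, hv⟩ := h1 v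
    obtain ⟨_, -, hlt⟩ := fractionalGraph_adj.1 ‹_›
    exact hlt.ne hv
  · obtain ⟨h, hpos⟩ := supportGraph_adj.1 huv
    rcases (hx.mem.2.2 ⟨s(u, v), h⟩).2.lt_or_eq with hlt | heq
    · exact .inl (fractionalGraph_adj.2 ⟨h, hpos, hlt⟩)
    · exact .inr (huniq u v h heq)

lemma IsFundamental.isHamiltonian [Nonempty V] {G : SimpleGraph V} (hG : IsFundamental G)
    (hconn : G.Preconnected) : G.IsHamiltonian := by
  obtain ⟨x, hx | hx, rfl⟩ := hG
  · exact hx.isHamiltonian hconn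
  · obtain ⟨v, p, hp, -⟩ := hx.hamiltonian
    exact IsHamiltonian.mono fractionalGraph_le fun _ => ⟨v, p, hp⟩

lemma IsFundamental.isRegularOfDegree {G : SimpleGraph V} [DecidableRel G.Adj]
    (hG : IsFundamental G) : G.IsRegularOfDegree 3 := by
  obtain ⟨x, hx, rfl⟩ := hG
  have h := hx.elim (fun h => h.cubic) fun h => h.cubic
  convert h

end

end TSP

theorem corollary1 {V : Type*} [Fintype V] [DecidableEq V] [Nonempty V]
    (G : SimpleGraph V) [DecidableRel G.Adj] (hconn : G.IsEdgeConnected 3)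
    (f : V → ℝ) (hf : ∀ v, 0 ≤ f v) :
    (G.IsRegularOfDegree 3 → ∀ lam : ℝ,
      TSP.everywhereVector G lam ∈ TSP.tourPolyhedron V →
        TSP.OPT (TSP.nodeWeightedCost G f) ≤ 3 / 2 * lam * TSP.LP (TSP.nodeWeightedCost G f)) ∧
    (G.IsRegularOfDegree 3 → G.IsHamiltonian →
      TSP.OPT (TSP.nodeWeightedCost G f) ≤ 9 / 7 * TSP.LP (TSP.nodeWeightedCost G f)) ∧
    (TSP.IsFundamental G → G.IsHamiltonian ∧
      TSP.OPT (TSP.nodeWeightedCost G f) ≤ 9 / 7 * TSP.LP (TSP.nodeWeightedCost G f)) := by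
  have hH := fun hF : TSP.IsFundamental G =>
    hF.isHamiltonian (hconn.preconnected (by norm_num))
  exact ⟨fun hG _ hlam => TSP.OPT_le_of_everywhereVector_mem hconn hG hf hlam,
    fun hG hHam => TSP.OPT_le_LP_of_isHamiltonian hconn hG hHam hf,
    fun hF => ⟨hH hF, TSP.OPT_le_LP_of_isHamiltonian hconn hF.isRegularOfDegree (hH hF) hf⟩⟩
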